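/- \textbf{Conventions.} Let $d\ge 1$ and equip $\mathbb{R}^d$ with the distance $\mathrm{dist}_\infty$ of the norm $\|x\|_\infty=\max_i|x_i|$. A \emph{cube} is a closed ball $\{y:\|y-x\|_\infty\le\rho\}$ of radius $\mathrm{rad}=\rho>0$ for this norm. A \emph{system of cubes} for a compact set $E\subset\mathbb{R}^d$ is a family of cubes $(S_I)$, indexed by finite words $I$ of natural numbers starting from the empty word $\emptyset$, such that each $S_I$ contains its finitely many children $S_{I,1},\dots,S_{I,k_I}$; $\mathrm{rad}(S_{i_1,\dots,i_n})\to 0$ as $n\to\infty$ for every infinite word $i_1,i_2,\dots$ of indices of the construction; and $$E=\bigcap_{n\ge 0}\ \bigcup_{\ell(I)=n}S_I ,$$ where $\ell(I)$ is the length of $I$. Put $h_I:=\max_{x\in S_I}\mathrm{dist}_\infty(x,E)$. The \emph{thickness} of $E$ associated to the system is $$\tau(E,\{S_I\}_I):=\inf_{I}\frac{\min_i \mathrm{rad}(S_{I,i})}{h_I}\in[0,\infty],$$ where the quotient is $+\infty$ if $h_I=0$. The system is \emph{$r$-uniformly dense} if for every word $I$ and every cube $B\subseteq S_I$ with $\mathrm{rad}(B)\ge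 r\,\mathrm{rad}(S_I)$ there is a child $S_{I,i}\subseteq B$. For $v$ in the Euclidean unit sphere $S^{d-1}$, let $$\Delta_v(E):=\{t\ge 0:\ \text{there are } e_1,e_2\in E \text{ with } e_1-e_2=tv\}.$$ \textbf{Corollary (directional distance sets).} Let $r\in(0,1/3]$ and $R>0$. There is $a>0$, depending only on $r$ and $R$, such that the following holds for every $d\ge 1$. If $E\subset\mathbb{R}^d$ is a compact set with a system of cubes $\{S_I\}_I$ that is $r$-uniformly dense, satisfies $\mathrm{rad}(S_\emptyset)=R$, and has thickness $\tau(E,\{S_I\}_I)\ge \frac{1}{1-2r}$, then $$[0,a]\subseteq\Delta_v(E)\qquad\text{for every } v\in S^{d-1}.$$ -/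

import Mathlib

open Set Filter Topology
open scoped ENNReal

/-- A system of closed cubes in `ℝ^d`, where `Fin d → ℝ` carries the distance of the infinity norm,
so that `Metric.closedBall c ρ` is the closed cube with centre `c` and radius `ρ`.
Cubes are indexed by words in the natural numbers: the children of the cube of the word `I` are the
cubes of the words `I ++ [j]`, `j < numChildren I`. Words that do not arise in this way from the
empty word carry no information. -/
structure CubeSystem (d : ℕ) where
  /-- The (finite) number of children of each cube. -/
  numChildren : List ℕ → ℕ
  /-- The centre of each cube. -/
  center : List ℕ → (Fin d → ℝ)
  /-- The radius of each cube. -/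
  radius : List ℕ → ℝ

namespace CubeSystem

variable {d : ℕ}

/-- The finite words of indices that occur in the construction. -/
inductive IsWord (S : CubeSystem d) : List ℕ → Prop
  | nil : IsWord S []
  | snoc (I : List ℕ) (j : ℕ) : IsWord S I → j < S.numChildren I → IsWord S (I ++ [j])

/-- The closed cube `S_I`. -/
def cube (S : CubeSystem d) (I : List ℕ) : Set (Fin d → ℝ) :=
  Metric.closedBall (S.center I) (S.radius I)

/-- `S` is a system of cubes for `C`: the cubes are nondegenerate, each one contains its children,
the radii tend to `0` along every infinite word of the construction, and
`C = ⋂ n, ⋃ (I of length n), S_I`. -/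
structure IsSystemFor (S : CubeSystem d) (C : Set (Fin d → ℝ)) : Prop where
  radius_pos : ∀ I, S.IsWord I → 0 < S.radius I
  child_subset : ∀ I, S.IsWord I → ∀ j < S.numChildren I, S.cube (I ++ [j]) ⊆ S.cube I
  tendsto_radius : ∀ i : ℕ → ℕ, (∀ n, S.IsWord ((List.range n).map i)) →
    Tendsto (fun n => S.radius ((List.range n).map i)) atTop (𝓝 0)
  eq_iInter : C = ⋂ n : ℕ, ⋃ I ∈ {I : List ℕ | S.IsWord I ∧ I.length = n}, S.cube I

/-- `h_I`, the largest distance of a point of `S_I` to `C`. -/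
noncomputable def gapSize (S : CubeSystem d) (C : Set (Fin d → ℝ)) (I : List ℕ) : ℝ≥0∞ :=
  ⨆ x ∈ S.cube I, Metric.infEDist x C

/-- The thickness of `C` associated to the system of cubes `S`, the infimum over all words `I` of
`(min_j rad S_{I,j}) / h_I`, a quotient that is `∞` when `h_I = 0`. -/
noncomputable def thickness (S : CubeSystem d) (C : Set (Fin d → ℝ)) : ℝ≥0∞ :=
  ⨅ I ∈ {I : List ℕ | S.IsWord I},
    (⨅ j ∈ {j : ℕ | j < S.numChildren I}, ENNReal.ofReal (S.radius (I ++ [j]))) / S.gapSize C I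

/-- `S` is `r`-uniformly dense: every cube contained in some `S_I` and of radius at least
`r * rad S_I` contains a child of `S_I`. -/
def IsUniformlyDense (S : CubeSystem d) (r : ℝ) : Prop :=
  ∀ I, S.IsWord I → ∀ (c : Fin d → ℝ) (ρ : ℝ), 0 < ρ →
    Metric.closedBall c ρ ⊆ S.cube I → r * S.radius I ≤ ρ →
      ∃ j < S.numChildren I, S.cube (I ++ [j]) ⊆ Metric.closedBall c ρ

end CubeSystem

/-- `Δ_v(E)`, the set of all distances between points of `E` in the direction `v`, where `v` is
meant to be a unit vector for the Euclidean norm. -/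
def directionalDistanceSet {d : ℕ} (v : EuclideanSpace ℝ (Fin d)) (E : Set (Fin d → ℝ)) : Set ℝ :=
  {t : ℝ | 0 ≤ t ∧ ∃ e₁ ∈ E, ∃ e₂ ∈ E, e₁ - e₂ = t • WithLp.ofLp v}

namespace CubeSystem

variable {d : ℕ} {S : CubeSystem d} {E : Set (Fin d → ℝ)} {r : ℝ}

/-! This is a gap lemma for `E` and its translate by `u = t • v`. Let `S_L` be linked: some `x ∈ E`
lies well inside `S_L + u`. Choose `S_I` of radius at least `r * rad S_L` with a smaller child
containing `x`; density puts a child of `S_L`, moved by `u`, inside `S_I`. Thickness bounds the gaps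
in a cube by `1 - 2r` times the radius of any child, so the larger of the two children is linked
again, by `u` or `-u` (`Linked.exists_smaller`). Radii shrink by a factor `r` each time, so `u` is a
limit of differences of points of `E`, and compactness finishes (`Linked.exists_sub_eq`). For small
`t` the root cube is linked. -/

/-- A closed ball of the infinity norm inside another one bounds the distance of the centres. -/
theorem add_dist_le_of_closedBall_subset [Nonempty (Fin d)] {c c' : Fin d → ℝ} {ρ ρ' : ℝ}
    (hρ : 0 ≤ ρ) (h : Metric.closedBall c ρ ⊆ Metric.closedBall c' ρ') : dist c c' + ρ ≤ ρ' := by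
  obtain ⟨i₀⟩ := ‹Nonempty (Fin d)›
  have key : ∀ i, |c i - c' i| + ρ ≤ ρ' := by
    intro i
    have h₁ : ∀ s : ℝ, |s| ≤ ρ → |c i + s - c' i| ≤ ρ' := by
      intro s hs
      have hx : Function.update c i (c i + s) ∈ Metric.closedBall c ρ := by
        rw [Metric.mem_closedBall, dist_pi_le_iff hρ]
        intro k
        rcases eq_or_ne k i with rfl | hk
        · simpa [Real.dist_eq] using hs
        · simpa [hk] using hρ
      have := (dist_le_pi_dist _ _ i).trans (Metric.mem_closedBall.1 (h hx))
      simpa [Real.dist_eq] using this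
    have h₂ := abs_le.1 (h₁ ρ (abs_of_nonneg hρ).le)
    have h₃ := abs_le.1 (h₁ (-ρ) (by rw [abs_neg, abs_of_nonneg hρ]))
    rcases abs_cases (c i - c' i) with h₄ | h₄ <;> linarith
  have hρ' : 0 ≤ ρ' - ρ := by linarith [key i₀, abs_nonneg (c i₀ - c' i₀)]
  have : dist c c' ≤ ρ' - ρ := (dist_pi_le_iff hρ').2 fun i => by
    rw [Real.dist_eq]; linarith [key i]
  linarith

/-- A ball of radius `σ ≤ ρ` through a given point of a ball of radius `ρ` fits into that ball. -/
theorem exists_closedBall_subset {V : Type*} [NormedAddCommGroup V] [NormedSpace ℝ V]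
    {x c : V} {ρ σ : ℝ} (hx : dist x c ≤ ρ) (hσ : 0 ≤ σ) (hσρ : σ ≤ ρ) :
    ∃ p, dist p x ≤ σ ∧ Metric.closedBall p σ ⊆ Metric.closedBall c ρ := by
  rcases hσ.eq_or_lt with rfl | hσ'
  · exact ⟨x, by simp, by simpa using hx⟩
  have hρ : 0 < ρ := hσ'.trans_le hσρ
  have hq : σ / ρ ≤ 1 := (div_le_one hρ).2 hσρ
  have hq0 : 0 ≤ σ / ρ := by positivity
  refine ⟨AffineMap.lineMap x c (σ / ρ), ?_, Metric.closedBall_subset_closedBall' ?_⟩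
  · rw [dist_lineMap_left, Real.norm_of_nonneg hq0]
    calc σ / ρ * dist x c ≤ σ / ρ * ρ := by gcongr
      _ = σ := by field_simp
  · rw [dist_lineMap_right, Real.norm_of_nonneg (sub_nonneg.2 hq)]
    calc σ + (1 - σ / ρ) * dist x c ≤ σ + (1 - σ / ρ) * ρ := by
          gcongr
      _ = ρ := by field_simp; ring

/-! ### Words and branches -/

theorem IsWord.of_append {I : List ℕ} : ∀ {K : List ℕ}, S.IsWord (I ++ K) → S.IsWord I := by
  intro K
  induction K using List.reverseRecOn with
  | nil => simp
  | append_singleton K j ih =>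
    intro h
    rw [← List.append_assoc] at h
    generalize hL : I ++ K ++ [j] = L at h
    cases h with
    | nil => simp at hL
    | snoc L k hL' hk =>
      obtain ⟨rfl, -⟩ := List.append_inj' hL rfl
      exact ih hL'

theorem IsWord.lt_numChildren {I : List ℕ} {j : ℕ} (h : S.IsWord (I ++ [j])) :
    j < S.numChildren I := by
  generalize hL : I ++ [j] = L at h
  cases h with
  | nil => simp at hL
  | snoc L k hL' hk =>
    obtain ⟨rfl, h⟩ := List.append_inj' hL rfl
    simp only [List.cons.injEq, and_true] at h
    exact h ▸ hk

theorem IsSystemFor.cube_append_subset (hS : S.IsSystemFor E) {I : List ℕ} :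
    ∀ {K : List ℕ}, S.IsWord (I ++ K) → S.cube (I ++ K) ⊆ S.cube I := by
  intro K
  induction K using List.reverseRecOn with
  | nil => simp
  | append_singleton K j ih =>
    intro h
    rw [← List.append_assoc] at h ⊢
    exact (hS.child_subset _ h.of_append j h.lt_numChildren).trans (ih h.of_append)

/-- The word `I` has extensions of every length whose cubes contain `x`. -/
def HasExtensions (S : CubeSystem d) (x : Fin d → ℝ) (I : List ℕ) : Prop :=
  ∀ n, ∃ K : List ℕ, K.length = n ∧ S.IsWord (I ++ K) ∧ x ∈ S.cube (I ++ K)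

/-- König's lemma: there are finitely many children, so one of them starts extensions of unboundedly
many lengths; truncation gives every length. -/
theorem HasExtensions.exists_child (hS : S.IsSystemFor E) {x : Fin d → ℝ} {I : List ℕ}
    (h : S.HasExtensions x I) : ∃ j, S.HasExtensions x (I ++ [j]) := by
  have h₁ : ∀ n, ∃ j : Fin (S.numChildren I), ∃ K : List ℕ, K.length = n ∧
      S.IsWord (I ++ [(j : ℕ)] ++ K) ∧ x ∈ S.cube (I ++ [(j : ℕ)] ++ K) := by
    intro n
    obtain ⟨K, hK, hw, hx⟩ := h (n + 1)
    obtain ⟨j, K, rfl⟩ := List.exists_cons_of_length_eq_add_one hK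
    rw [← List.singleton_append, ← List.append_assoc] at hw hx
    exact ⟨⟨j, hw.of_append.lt_numChildren⟩, K, by simpa using hK, hw, hx⟩
  choose f hf using h₁
  obtain ⟨j, hj⟩ := Finite.exists_infinite_fiber f
  rw [Set.infinite_coe_iff] at hj
  refine ⟨j, fun n => ?_⟩
  obtain ⟨m, hm, hnm⟩ := hj.exists_gt n
  obtain ⟨K, hK, hw, hx⟩ := hf m
  rw [show f m = j from hm, ← List.take_append_drop n K, ← List.append_assoc] at hw hx
  exact ⟨K.take n, by simp; omega, hw.of_append, hS.cube_append_subset hw hx⟩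

/-- Every point of `E` lies in all cubes along some infinite word. -/
theorem IsSystemFor.exists_branch (hS : S.IsSystemFor E) {x : Fin d → ℝ} (hx : x ∈ E) :
    ∃ i : ℕ → ℕ, ∀ n, S.IsWord ((List.range n).map i) ∧ x ∈ S.cube ((List.range n).map i) := by
  have h₀ : S.HasExtensions x [] := by
    intro n
    rw [hS.eq_iInter] at hx
    obtain ⟨I, ⟨hI, hn⟩, hxI⟩ := Set.mem_iUnion₂.1 (Set.mem_iInter.1 hx n)
    exact ⟨I, hn, hI, hxI⟩
  choose f hf using fun I : {I // S.HasExtensions x I} => I.2.exists_child hS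
  let W : ℕ → {I // S.HasExtensions x I} := fun n =>
    Nat.rec ⟨[], h₀⟩ (fun _ I => ⟨I.1 ++ [f I], hf I⟩) n
  have hW : ∀ n, (List.range n).map (fun n => f (W n)) = (W n).1 := by
    intro n
    induction n with
    | zero => rfl
    | succ n ih => rw [List.range_succ, List.map_append, ih]; rfl
  refine ⟨fun n => f (W n), fun n => ?_⟩
  rw [hW]
  obtain ⟨K, hK, hw, hx⟩ := (W n).2 0
  rw [List.length_eq_zero_iff] at hK
  subst hK
  simpa using And.intro hw hx

/-- A point of `E` lies in a cube of radius at least `σ` with a child of radius less than `σ`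
containing the point. -/
theorem IsSystemFor.exists_child_radius_lt (hS : S.IsSystemFor E) {x : Fin d → ℝ} (hx : x ∈ E)
    {σ : ℝ} (hσ : 0 < σ) (hσr : σ ≤ S.radius []) :
    ∃ I j, S.IsWord I ∧ j < S.numChildren I ∧ x ∈ S.cube I ∧ x ∈ S.cube (I ++ [j]) ∧
      σ ≤ S.radius I ∧ S.radius (I ++ [j]) < σ := by
  obtain ⟨i, hi⟩ := hS.exists_branch hx
  have hlt : ∃ n, S.radius ((List.range n).map i) < σ :=
    ((hS.tendsto_radius i fun n => (hi n).1).eventually_lt_const hσ).exists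
  classical
  have h₁ := Nat.find_spec hlt
  -- The root has radius at least `σ`, so the first cube of radius below `σ` has a parent.
  obtain ⟨n, hn⟩ : ∃ n, Nat.find hlt = n + 1 := by
    refine Nat.exists_eq_succ_of_ne_zero fun h => ?_
    rw [h] at h₁
    exact absurd h₁ (not_lt.2 (by simpa using hσr))
  rw [hn] at h₁
  have h₂ := hi (n + 1)
  have h₃ := Nat.find_min hlt (m := n) (by omega)
  simp only [List.range_succ, List.map_append, List.map_cons, List.map_nil] at h₁ h₂
  exact ⟨_, _, (hi n).1, h₂.1.lt_numChildren, (hi n).2, h₂.2, not_lt.1 h₃, h₁⟩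

/-! ### Thickness as a bound on gaps -/

/-- Points of `S_I` are within `θ` times the radius of any child of `S_I` from `E`. -/
def GapsLE (S : CubeSystem d) (E : Set (Fin d → ℝ)) (θ : ℝ) : Prop :=
  ∀ I, S.IsWord I → ∀ j < S.numChildren I, ∀ x ∈ S.cube I,
    ∃ e ∈ E, dist x e ≤ θ * S.radius (I ++ [j])

theorem IsSystemFor.gapsLE (hS : S.IsSystemFor E) (hE : IsCompact E) {θ : ℝ} (hθ : 0 < θ)
    (hτ : ENNReal.ofReal (1 / θ) ≤ S.thickness E) : S.GapsLE E θ := by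
  intro I hI j hj x hx
  have hρ : 0 < S.radius (I ++ [j]) := hS.radius_pos _ (.snoc I j hI hj)
  have h₁ : ENNReal.ofReal (1 / θ) ≤ ENNReal.ofReal (S.radius (I ++ [j])) / S.gapSize E I :=
    hτ.trans <| (iInf₂_le I hI).trans <| ENNReal.div_le_div_right (iInf₂_le j hj) _
  rw [ENNReal.le_div_iff_mul_le (.inr (by simpa using hρ)) (.inr ENNReal.ofReal_ne_top)] at h₁
  have h₂ : S.gapSize E I ≤ ENNReal.ofReal (θ * S.radius (I ++ [j])) := by
    calc S.gapSize E I = ENNReal.ofReal θ * (ENNReal.ofReal (1 / θ) * S.gapSize E I) := by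
          rw [← mul_assoc, ← ENNReal.ofReal_mul hθ.le, mul_one_div_cancel hθ.ne']; simp
      _ ≤ ENNReal.ofReal θ * ENNReal.ofReal (S.radius (I ++ [j])) := by gcongr
      _ = _ := (ENNReal.ofReal_mul hθ.le).symm
  have h₃ : Metric.infEDist x E ≤ ENNReal.ofReal (θ * S.radius (I ++ [j])) :=
    (le_iSup₂ (f := fun x (_ : x ∈ S.cube I) => Metric.infEDist x E) x hx).trans h₂
  -- For empty `E` the distance in `h₃` would be infinite.
  have hne : E.Nonempty := by
    rw [Set.nonempty_iff_ne_empty]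
    rintro rfl
    simp at h₃
  obtain ⟨e, he, hxe⟩ := hE.exists_infEDist_eq_edist hne x
  rw [hxe, edist_dist, ENNReal.ofReal_le_ofReal_iff (by positivity)] at h₃
  exact ⟨e, he, h₃⟩

/-! ### Linked cubes -/

/-- The cube `S_I` translated by `u` meets `E` well inside. -/
def Linked (S : CubeSystem d) (E : Set (Fin d → ℝ)) (r : ℝ) (u : Fin d → ℝ) (I : List ℕ) : Prop :=
  S.IsWord I ∧ ∃ x ∈ E, dist x (S.center I + u) ≤ (1 - 2 * r) * S.radius I

/-- A linked cube produces a smaller linked cube, of `S` or of its translate. -/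
theorem Linked.exists_smaller [Nonempty (Fin d)] (hS : S.IsSystemFor E) (hr₀ : 0 < r)
    (hr : r < 1 / 2) (hgap : S.GapsLE E (1 - 2 * r)) (hd : S.IsUniformlyDense r)
    {u : Fin d → ℝ} {L : List ℕ} (hL : S.Linked E r u L) (hLr : S.radius L ≤ S.radius []) :
    ∃ L', (S.Linked E r u L' ∨ S.Linked E r (-u) L') ∧ S.radius L' ≤ r * S.radius L := by
  obtain ⟨hLw, x, hxE, hx⟩ := hL
  have hρ := hS.radius_pos L hLw
  have hσ : 0 < r * S.radius L := by positivity
  have hσρ : r * S.radius L ≤ S.radius [] := by nlinarith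
  obtain ⟨I, i, hI, hi, hxI, hxi, hge, hlt⟩ := hS.exists_child_radius_lt hxE hσ hσρ
  obtain ⟨p, hpx, hp⟩ := exists_closedBall_subset hxI hσ.le hge
  -- Source of the constant `1 - 2r`: in units of `rad S_L`, the offset `1 - 2r` of `x`, then `r`
  -- from `x` to `p`, then the radius `r` add up to 1.
  have hpL : Metric.closedBall (p - u) (r * S.radius L) ⊆ S.cube L := by
    refine Metric.closedBall_subset_closedBall' ?_
    have h₁ : dist (p - u) (S.center L) = dist p (S.center L + u) := by
      simp only [dist_eq_norm]; congr 1; abel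
    have h₂ := dist_triangle p x (S.center L + u)
    rw [h₁]; linarith
  obtain ⟨l, hl, hlp⟩ := hd L hLw _ _ hσ hpL le_rfl
  have hlρ := hS.radius_pos _ (.snoc L l hLw hl)
  have hnest := add_dist_le_of_closedBall_subset hlρ.le hlp
  have hθ : 0 < 1 - 2 * r := by linarith
  rcases le_total (S.radius (L ++ [l])) (S.radius (I ++ [i])) with hle | hle
  · have hc : S.center (I ++ [i]) - u ∈ S.cube L := by
      have h₁ : dist (S.center (I ++ [i]) - u) (S.center L)
          = dist (S.center (I ++ [i])) (S.center L + u) := by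
        simp only [dist_eq_norm]; congr 1; abel
      have h₂ := dist_triangle (S.center (I ++ [i])) x (S.center L + u)
      have h₃ : dist x (S.center (I ++ [i])) ≤ S.radius (I ++ [i]) := hxi
      rw [dist_comm] at h₃
      rw [cube, Metric.mem_closedBall, h₁]; linarith
    obtain ⟨e, he, hde⟩ := hgap L hLw l hl _ hc
    -- The roles are exchanged: `E` now meets a cube translated by `-u`.
    refine ⟨I ++ [i], .inr ⟨.snoc I i hI hi, e, he, ?_⟩, hlt.le⟩
    rw [dist_comm, ← sub_eq_add_neg]
    exact hde.trans (by gcongr)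
  · have hc : S.center (L ++ [l]) + u ∈ S.cube I := by
      refine hp ?_
      have h₁ : dist (S.center (L ++ [l]) + u) p = dist (S.center (L ++ [l])) (p - u) := by
        simp only [dist_eq_norm]; congr 1; abel
      rw [Metric.mem_closedBall, h₁]; linarith
    obtain ⟨e, he, hde⟩ := hgap I hI i hi _ hc
    refine ⟨L ++ [l], .inl ⟨.snoc L l hLw hl, e, he, ?_⟩, ?_⟩
    · rw [dist_comm]
      exact hde.trans (by gcongr)
    · linarith [dist_nonneg (x := S.center (L ++ [l])) (y := p - u)]

/-- The sign need not be tracked: swapping the two points of `E` turns a difference near `-u` into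
one near `u`. -/
theorem Linked.exists_radius_le [Nonempty (Fin d)] (hS : S.IsSystemFor E) (hr₀ : 0 < r)
    (hr : r < 1 / 2) (hgap : S.GapsLE E (1 - 2 * r)) (hd : S.IsUniformlyDense r)
    {u : Fin d → ℝ} (h : S.Linked E r u []) (n : ℕ) :
    ∃ L, (S.Linked E r u L ∨ S.Linked E r (-u) L) ∧ S.radius L ≤ r ^ n * S.radius [] := by
  have hR := hS.radius_pos [] .nil
  induction n with
  | zero => exact ⟨[], .inl h, by simp⟩
  | succ n ih =>
    obtain ⟨L, hL, hLr⟩ := ih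
    have hLr' : S.radius L ≤ S.radius [] := hLr.trans <|
      mul_le_of_le_one_left hR.le (pow_le_one₀ hr₀.le (by linarith))
    have hle : r * S.radius L ≤ r ^ (n + 1) * S.radius [] := by
      rw [pow_succ', mul_assoc]; gcongr
    rcases hL with hL | hL
    · obtain ⟨L', h₁, h₂⟩ := hL.exists_smaller hS hr₀ hr hgap hd hLr'
      exact ⟨L', h₁, h₂.trans hle⟩
    · obtain ⟨L', h₁, h₂⟩ := hL.exists_smaller hS hr₀ hr hgap hd hLr'
      rw [neg_neg] at h₁
      exact ⟨L', h₁.symm, h₂.trans hle⟩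

theorem IsUniformlyDense.exists_child_radius_le [Nonempty (Fin d)] (hS : S.IsSystemFor E)
    (hd : S.IsUniformlyDense r) (hr₀ : 0 < r) (hr₁ : r ≤ 1) {I : List ℕ} (hI : S.IsWord I) :
    ∃ j < S.numChildren I, S.radius (I ++ [j]) ≤ r * S.radius I := by
  have hρ := hS.radius_pos I hI
  obtain ⟨j, hj, hsub⟩ := hd I hI (S.center I) (r * S.radius I) (by positivity)
    (Metric.closedBall_subset_closedBall (mul_le_of_le_one_left hρ.le hr₁)) le_rfl
  have := add_dist_le_of_closedBall_subset (hS.radius_pos _ (.snoc I j hI hj)).le hsub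
  exact ⟨j, hj, by linarith [dist_nonneg (x := S.center (I ++ [j])) (y := S.center I)]⟩

/-- The factor `r`, due to a child inside the concentric cube of radius `r * rad S_I`, leaves room
in the root cube for a translation. -/
theorem exists_mem_dist_center_le [Nonempty (Fin d)] (hS : S.IsSystemFor E) (hr₀ : 0 < r)
    (hr : r < 1 / 2) (hgap : S.GapsLE E (1 - 2 * r)) (hd : S.IsUniformlyDense r)
    {I : List ℕ} (hI : S.IsWord I) :
    ∃ e ∈ E, dist e (S.center I) ≤ (1 - 2 * r) * (r * S.radius I) := by
  obtain ⟨j, hj, hjr⟩ := hd.exists_child_radius_le hS hr₀ (by linarith) hI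
  obtain ⟨e, he, hde⟩ := hgap I hI j hj _ (Metric.mem_closedBall_self (hS.radius_pos I hI).le)
  rw [dist_comm] at hde
  exact ⟨e, he, hde.trans (mul_le_mul_of_nonneg_left hjr (by linarith))⟩

theorem Linked.exists_dist_le [Nonempty (Fin d)] (hS : S.IsSystemFor E) (hr₀ : 0 < r)
    (hr : r < 1 / 2) (hgap : S.GapsLE E (1 - 2 * r)) (hd : S.IsUniformlyDense r)
    {u : Fin d → ℝ} {L : List ℕ} (hL : S.Linked E r u L) :
    ∃ x ∈ E, ∃ y ∈ E, dist (x - y) u ≤ 2 * S.radius L := by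
  obtain ⟨hLw, x, hx, hdx⟩ := hL
  obtain ⟨y, hy, hdy⟩ := exists_mem_dist_center_le hS hr₀ hr hgap hd hLw
  have hρ := hS.radius_pos L hLw
  refine ⟨x, hx, y, hy, ?_⟩
  have h₁ : dist (x - y) u = dist x (y + u) := by
    simp only [dist_eq_norm]; congr 1; abel
  have h₂ := dist_triangle x (S.center L + u) (y + u)
  rw [dist_add_right, dist_comm (S.center L)] at h₂
  have h₃ : (1 - 2 * r) * (r * S.radius L) ≤ S.radius L := by
    rw [← mul_assoc]; exact mul_le_of_le_one_left hρ.le (by nlinarith)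
  have h₄ : (1 - 2 * r) * S.radius L ≤ S.radius L := mul_le_of_le_one_left hρ.le (by linarith)
  linarith

/-- If the first cube is linked with respect to the translation by `u`, then `u` is a difference of
two points of `E`. -/
theorem Linked.exists_sub_eq [Nonempty (Fin d)] (hS : S.IsSystemFor E) (hE : IsCompact E)
    (hr₀ : 0 < r) (hr : r < 1 / 2) (hgap : S.GapsLE E (1 - 2 * r)) (hd : S.IsUniformlyDense r)
    {u : Fin d → ℝ} (h : S.Linked E r u []) : ∃ e₁ ∈ E, ∃ e₂ ∈ E, e₁ - e₂ = u := by
  have hR := hS.radius_pos [] .nil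
  have hK : IsCompact (Set.image2 (fun x y => x - y) E E) := by
    rw [← Set.image_prod]
    exact (hE.prod hE).image continuous_sub
  suffices u ∈ closure (Set.image2 (fun x y => x - y) E E) by
    rwa [hK.isClosed.closure_eq] at this
  rw [Metric.mem_closure_iff]
  intro ε hε
  have hlim : Tendsto (fun n : ℕ => 2 * (r ^ n * S.radius [])) atTop (𝓝 0) := by
    simpa using ((tendsto_pow_atTop_nhds_zero_of_lt_one hr₀.le (by linarith)).mul_const
      (S.radius [])).const_mul 2
  obtain ⟨n, hn⟩ := (hlim.eventually_lt_const hε).exists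
  obtain ⟨L, hL, hLr⟩ := h.exists_radius_le hS hr₀ hr hgap hd n
  rcases hL with hL | hL
  · obtain ⟨x, hx, y, hy, hxy⟩ := hL.exists_dist_le hS hr₀ hr hgap hd
    exact ⟨x - y, Set.mem_image2_of_mem hx hy, by rw [dist_comm]; linarith⟩
  · obtain ⟨x, hx, y, hy, hxy⟩ := hL.exists_dist_le hS hr₀ hr hgap hd
    refine ⟨y - x, Set.mem_image2_of_mem hy hx, ?_⟩
    rw [← dist_neg_neg, neg_sub, dist_comm]
    linarith

end CubeSystem

theorem mainTheorem5 (r : ℝ) (hr₀ : 0 < r) (hr : r ≤ 1 / 3) (R : ℝ) (hR : 0 < R) :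
    ∃ a : ℝ, 0 < a ∧
      ∀ (d : ℕ) (E : Set (Fin d → ℝ)) (S : CubeSystem d),
        IsCompact E → S.IsSystemFor E → S.radius [] = R →
        ENNReal.ofReal (1 / (1 - 2 * r)) ≤ S.thickness E →
        S.IsUniformlyDense r →
        ∀ v ∈ Metric.sphere (0 : EuclideanSpace ℝ (Fin d)) 1,
          Set.Icc 0 a ⊆ directionalDistanceSet v E := by
  have hθ : 0 < 1 - 2 * r := by linarith
  have hr₁ : 0 < 1 - r := by linarith
  have hr₂ : r < 1 / 2 := by linarith
  -- Linking the root allows an offset `(1 - 2r)R`, of which the distance from `E` to its centre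
  -- uses at most `(1 - 2r)rR`.
  refine ⟨(1 - 2 * r) * ((1 - r) * R), by positivity, ?_⟩
  intro d E S hE hS hSR hτ hd v hv t ht
  have hv₁ : ‖v‖ = 1 := by simpa using hv
  -- Dimension 0 has no unit vector.
  have : Nonempty (Fin d) := by
    by_contra hd₀
    rw [not_nonempty_iff] at hd₀
    rw [Subsingleton.elim v 0, norm_zero] at hv₁
    exact zero_ne_one hv₁
  have hgap := hS.gapsLE hE hθ hτ
  have hu : ‖t • WithLp.ofLp v‖ ≤ t := by
    rw [norm_smul, Real.norm_of_nonneg ht.1]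
    refine mul_le_of_le_one_right ht.1 ((pi_norm_le_iff_of_nonneg zero_le_one).2 fun i => ?_)
    exact hv₁ ▸ PiLp.norm_apply_le v i
  refine ⟨ht.1, CubeSystem.Linked.exists_sub_eq hS hE hr₀ hr₂ hgap hd ⟨.nil, ?_⟩⟩
  obtain ⟨e, he, hde⟩ := CubeSystem.exists_mem_dist_center_le hS hr₀ hr₂ hgap hd .nil
  refine ⟨e, he, (dist_triangle _ (S.center []) _).trans ?_⟩
  rw [dist_self_add_right]
  rw [hSR] at hde ⊢
  linarith [ht.2]
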